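/- Let $k$ be a field with $|k|\ge\aleph_1$, let $n\ge 2$, and let $R_0=k[X_1,\dots,X_n]$. For an integral domain $R$ that is not a field, with field of fractions $K$, order the set $S=R\setminus\{0\}$ by divisibility. The ideals $sR$ ($s\in S$) are cofinal among all non-zero ideals of $R$, and $R$ is called complete (in its adic topology, the topology defined by all non-zero ideals) if the canonical map $$R\longrightarrow \varprojlim_{s\in S} R/sR$$ is an isomorphism; for noetherian $R$ this is equivalent to $\operatorname{Ext}^1_R(K,R)=0$. Let $U\subset R_0$ be a multiplicative subset with $0\notin U$, let $R=U^{-1}R_0$, and assume that every maximal ideal of $R$ contracts to a maximal ideal of $R_0$. Then $R$ is complete, and $\operatorname{Ext}^1_R(K,R)=0$, where $K$ is the field of fractions of $R$. In particular, the polynomial ring $R=k[X_1,\dots,X_n]$ (conjecture of Jensen), and its localization $R=(k[X_1,\dots,X_n])_{\mathfrak m}$ at any maximal ideal $\mathfrak m$ (conjecture of Gruson), are complete and satisfy $\operatorname{Ext}^1_R(K,R)=0$. -/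

import Mathlib

open scoped Cardinal

universe u v

/-- The inverse limit of the rings `R ⧸ sR`, where `s` runs through the non-zero elements of `R`
preordered by divisibility: the transition map for `s ∣ t` is the projection `R ⧸ tR → R ⧸ sR`.
When `R` is an integral domain, the ideals `sR` with `s ≠ 0` are cofinal among all non-zero ideals,
so this is the completion of `R` in the topology defined by all non-zero ideals. -/
def nonzeroAdicCompletion (R : Type*) [CommRing R] :
    Subring ((s : {s : R // s ≠ 0}) → R ⧸ Ideal.span {s.1}) where
  carrier := {x | ∀ (s t : {s : R // s ≠ 0}) (h : s.1 ∣ t.1),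
    Ideal.Quotient.factor (Ideal.span_singleton_le_span_singleton.mpr h) (x t) = x s}
  mul_mem' := by
    intro a b ha hb s t h
    simp only [Pi.mul_apply, map_mul, ha s t h, hb s t h]
  one_mem' := by
    intro s t h
    simp only [Pi.one_apply, map_one]
  add_mem' := by
    intro a b ha hb s t h
    simp only [Pi.add_apply, map_add, ha s t h, hb s t h]
  zero_mem' := by
    intro s t h
    simp only [Pi.zero_apply, map_zero]
  neg_mem' := by
    intro a ha s t h
    simp only [Pi.neg_apply, map_neg, ha s t h]

/-- The canonical ring homomorphism from `R` to its completion, sending `r` to the family of its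
residue classes. -/
def toNonzeroAdicCompletion (R : Type*) [CommRing R] : R →+* nonzeroAdicCompletion R :=
  RingHom.codRestrict
    (RingHom.pi fun s : {s : R // s ≠ 0} => Ideal.Quotient.mk (Ideal.span {s.1}))
    (nonzeroAdicCompletion R)
    (by
      intro r s t h
      exact Ideal.Quotient.factor_mk _ r)

/-- `R` is complete in the topology defined by all non-zero ideals: the canonical map from `R` to
its completion is an isomorphism. -/
def IsNonzeroAdicComplete (R : Type*) [CommRing R] : Prop :=
  Function.Bijective (toNonzeroAdicCompletion R)

/-- The vanishing of `Ext¹_R(K, R)`, where `K` is the ring of fractions of `R` (its field of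
fractions, when `R` is an integral domain). -/
def ExtOneFractionRingVanishes (R : Type*) [CommRing R] : Prop :=
  Subsingleton
    (CategoryTheory.Abelian.Ext (ModuleCat.of R (FractionRing R)) (ModuleCat.of R R) 1)

/-!
An element of `lim R ⧸ sR` is lifted to a family `x s ∈ R` with `s ∣ x t - x s` whenever `s ∣ t`;
completeness means that every such family is congruent to a constant.

Completeness descends from `R ⊗ K[X]` (over `k[X]`), where `K` is the algebraic closure of `k`,
because a `k`-linear retraction `K → k` induces an `R`-linear retraction onto `R` and every non-zero
element of the larger ring divides one of `R` (`IsDvdComplete.of_retraction`). So `k` may be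
taken algebraically closed, and a maximal ideal of `R` is a rational point, say the origin.

The homomorphism `g(X) ↦ g(T X)` extends to `R → k[X]⟦T⟧`, and the family `x` has a limit
`∑ F d T ^ d` there, with `F d` a form of degree `d`. Its restriction to a line through the origin is
a rational function of `T`, because the line lies in a hyperplane `ℓ = 0` (here `n ≥ 2` is used) and
`x ℓ` is an element of `R`. Thus for every point `a` the sequence `F d (a)` satisfies a linear
recurrence. If `F` satisfied none over `k[X]`, it would have a non-zero Hankel minor of every size,
and over the uncountable field `k` there would be a point where none of these countably many
polynomials vanishes (`exists_recurrence`). A recurrence for `F` means that the limit is a fraction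
`p / q`, and Krull's intersection theorem shows that `q * x s - p` vanishes modulo `s` locally at the
origin, for each `s` (`IsDvdCoherent.exists_fraction`). Any other maximal ideal contains, together
with that of the origin, a prime element, the equation of a hyperplane through both points; by Krull's
theorem again, `q * x s - p` vanishes modulo `s` everywhere (`IsDvdCoherent.dvd_of_locally`). Then `q`
divides `p`, and `p / q ∈ R` is the limit of the family.

Completeness implies that `Hom(K, K) → Hom(K, K/R)` is onto, `K` now being the field of fractions: a
homomorphism `f : K → K/R` with `f 1 = 0` is given by a coherent family `x` through
`f (1/s) = x s / s`. As `K` is an injective module, `Ext¹(K, R) = 0`.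
-/

/-! ### Coherent families -/

/-- A family of elements `x s` of `R`, indexed by all `s` (the value at `s = 0` is irrelevant), whose
residue classes modulo `s ≠ 0` are compatible: lifts of the elements of `lim R ⧸ sR`. -/
def IsDvdCoherent {R : Type*} [CommRing R] (x : R → R) : Prop :=
  ∀ ⦃s t : R⦄, t ≠ 0 → s ∣ t → s ∣ x t - x s

/-- Every coherent family of elements of `R` is congruent to a constant one. For a domain that is
not a field this is completeness in the topology of all non-zero ideals. -/
def IsDvdComplete (R : Type*) [CommRing R] : Prop :=
  ∀ x : R → R, IsDvdCoherent x → ∃ r : R, ∀ s : R, s ≠ 0 → s ∣ x s - r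

theorem IsDvdComplete.isNonzeroAdicComplete {R : Type*} [CommRing R] [IsDomain R]
    (hR : ¬ IsField R) (h : IsDvdComplete R) : IsNonzeroAdicComplete R := by
  constructor
  · rw [injective_iff_map_eq_zero]
    intro a ha
    have key : ∀ s : R, s ≠ 0 → s ∣ a := fun s hs ↦ by
      have := congrFun (congrArg Subtype.val ha) ⟨s, hs⟩
      exact Ideal.mem_span_singleton.mp (Ideal.Quotient.eq_zero_iff_mem.mp this)
    by_contra ha0
    obtain ⟨p, hp0, hpu⟩ := Ring.exists_not_isUnit_of_not_isField hR
    obtain ⟨c, hc⟩ := key (a * p) (mul_ne_zero ha0 hp0)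
    refine hpu (IsUnit.of_mul_eq_one c ?_)
    apply mul_left_cancel₀ ha0
    rw [mul_one, ← mul_assoc, ← hc]
  · rintro ⟨y, hy⟩
    choose f hf using fun s : {s : R // s ≠ 0} ↦ Ideal.Quotient.mk_surjective (y s)
    classical
    obtain ⟨r, hr⟩ := h (fun s ↦ if hs : s ≠ 0 then f ⟨s, hs⟩ else 0) (by
      intro s t ht hst
      have hs : s ≠ 0 := ne_zero_of_dvd_ne_zero ht hst
      have := hy ⟨s, hs⟩ ⟨t, ht⟩ hst
      rw [← hf, ← hf, Ideal.Quotient.factor_mk, Ideal.Quotient.eq,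
        Ideal.mem_span_singleton] at this
      simpa [hs, ht] using this)
    refine ⟨r, Subtype.ext (funext fun s ↦ ?_)⟩
    have := hr s.1 s.2
    rw [dif_pos s.2] at this
    refine Eq.trans ?_ (hf s)
    exact ((Ideal.Quotient.eq).mpr (Ideal.mem_span_singleton.mpr this)).symm

/-! ### The vanishing of `Ext¹` -/

/-- Baer's criterion: a homomorphism `f : I → K` is multiplication by `f a / a`, for any `a ≠ 0`
in `I`. -/
theorem fractionRing_injective (R : Type v) [CommRing R] [IsDomain R] :
    Module.Injective R (FractionRing R) := by
  refine Module.Baer.injective fun I g ↦ ?_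
  by_cases hI : I = ⊥
  · subst hI
    refine ⟨0, fun x hx ↦ ?_⟩
    have : (⟨x, hx⟩ : (⊥ : Ideal R)) = 0 := Subtype.ext hx
    rw [this, map_zero, LinearMap.zero_apply]
  · obtain ⟨a, haI, ha⟩ := Submodule.exists_mem_ne_zero_of_ne_bot hI
    refine ⟨LinearMap.toSpanSingleton R _ (g ⟨a, haI⟩ / algebraMap R (FractionRing R) a),
      fun x hx ↦ ?_⟩
    have ha' : algebraMap R (FractionRing R) a ≠ 0 := by simpa using ha
    have : x • g ⟨a, haI⟩ = a • g ⟨x, hx⟩ := by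
      rw [← map_smul, ← map_smul]
      congr 1
      exact Subtype.ext (mul_comm _ _)
    rw [LinearMap.toSpanSingleton_apply, Algebra.smul_def, mul_div_assoc', ← Algebra.smul_def,
      this, Algebra.smul_def, mul_div_cancel_left₀ _ ha']

/-- Every homomorphism `f : K → K/R` lifts to `K`. After subtraction of a multiplication map,
`f 1 = 0`; then `f (1/s)` is the class of `x s / s` for a coherent family `x`, and if `x` is
congruent to `r`, then `f` is multiplication by `r`. -/
theorem IsDvdComplete.exists_lift {R K : Type*} [CommRing R] [IsDomain R] [Field K] [Algebra R K]
    [IsFractionRing R K] (h : IsDvdComplete R)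
    (f : K →ₗ[R] K ⧸ LinearMap.range (Algebra.linearMap R K)) :
    ∃ κ : K, ∀ y, f y = Submodule.Quotient.mk (κ * y) := by
  obtain ⟨κ, hκ⟩ := Submodule.Quotient.mk_surjective _ (f 1)
  choose z hz using fun s : R ↦ Submodule.Quotient.mk_surjective _ (f (algebraMap R K s)⁻¹)
  have hx : ∀ s : R, s ≠ 0 → ∃ x : R, algebraMap R K x = s • z s - κ := by
    intro s hs
    have hs' : algebraMap R K s ≠ 0 := by simpa using hs
    have : Submodule.Quotient.mk (s • z s) = (Submodule.Quotient.mk κ :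
        K ⧸ LinearMap.range (Algebra.linearMap R K)) := by
      rw [hκ, Submodule.Quotient.mk_smul, hz, ← map_smul, Algebra.smul_def, mul_inv_cancel₀ hs']
    rw [Submodule.Quotient.eq] at this
    exact this
  classical
  choose! x hx using hx
  obtain ⟨r, hr⟩ := h x (by
    intro s t ht ⟨u, hu⟩
    have hs : s ≠ 0 := by rintro rfl; simp [hu] at ht
    have hu0 : u ≠ 0 := by rintro rfl; simp [hu] at ht
    have hs' : algebraMap R K s ≠ 0 := by simpa using hs
    have hu' : algebraMap R K u ≠ 0 := by simpa using hu0
    have : Submodule.Quotient.mk (u • z t) = (Submodule.Quotient.mk (z s) :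
        K ⧸ LinearMap.range (Algebra.linearMap R K)) := by
      rw [Submodule.Quotient.mk_smul, hz, hz, ← map_smul, Algebra.smul_def, hu,
        map_mul (algebraMap R K),
        mul_inv_rev, mul_inv_cancel_left₀ hu']
    rw [Submodule.Quotient.eq] at this
    obtain ⟨c, hc⟩ := this
    refine ⟨c, IsFractionRing.injective R K ?_⟩
    rw [map_sub, hx t ht, hx s hs, map_mul, ← Algebra.linearMap_apply, ← Algebra.linearMap_apply,
      hc, Algebra.linearMap_apply, hu, mul_smul]
    simp only [Algebra.smul_def]
    ring)
  refine ⟨κ + algebraMap R K r, fun y ↦ ?_⟩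
  obtain ⟨b, s, hs, rfl⟩ := IsFractionRing.div_surjective (A := R) y
  have hs0 : s ≠ 0 := nonZeroDivisors.ne_zero hs
  have hs' : algebraMap R K s ≠ 0 := by simpa using hs0
  rw [div_eq_mul_inv, ← Algebra.smul_def, map_smul, ← hz, ← Submodule.Quotient.mk_smul,
    Submodule.Quotient.eq]
  obtain ⟨c, hc⟩ := hr s hs0
  refine ⟨b * c, ?_⟩
  have h1 := hx s hs0
  have h2 : z s = (algebraMap R K r + algebraMap R K s * algebraMap R K c + κ) /
      algebraMap R K s := by
    rw [eq_div_iff hs', ← map_mul, ← hc, map_sub, h1, Algebra.smul_def]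
    ring
  rw [Algebra.linearMap_apply, h2, Algebra.smul_def, Algebra.smul_def, map_mul]
  field_simp
  ring

open CategoryTheory in
/-- In the long exact sequence of `0 → R → K → K/R → 0`, the map `Hom(K, K) → Hom(K, K/R)` is onto
by completeness and `Ext¹(K, K) = 0` by injectivity of `K`. -/
theorem IsDvdComplete.extOneFractionRingVanishes {R : Type v} [CommRing R] [IsDomain R]
    (h : IsDvdComplete R) : ExtOneFractionRingVanishes R := by
  let K := FractionRing R
  let i : R →ₗ[R] K := Algebra.linearMap R K
  let S : ShortComplex (ModuleCat.{v} R) :=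
    ShortComplex.mk (ModuleCat.ofHom i) (ModuleCat.ofHom (LinearMap.range i).mkQ)
      (by ext; simp)
  have hS : S.ShortExact :=
    { exact := (ShortComplex.ShortExact.moduleCat_exact_iff_function_exact S).mpr (by
        intro y
        simp [S])
      mono_f := (ModuleCat.mono_iff_injective _).mpr (IsFractionRing.injective R K)
      epi_g := (ModuleCat.epi_iff_surjective _).mpr (Submodule.mkQ_surjective _) }
  have : Injective (ModuleCat.of R K) :=
    have := fractionRing_injective R
    Module.injective_object_of_injective_module R K
  change Subsingleton (Abelian.Ext (ModuleCat.of R K) (ModuleCat.of R R) 1)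
  refine subsingleton_of_forall_eq 0 fun e ↦ ?_
  obtain ⟨φ, rfl⟩ := Abelian.Ext.covariant_sequence_exact₁ (ModuleCat.of R K) hS e
    (Abelian.Ext.eq_zero_of_injective (I := ModuleCat.of R K) _) (zero_add 1)
  obtain ⟨g, rfl⟩ := Abelian.Ext.homEquiv₀.symm.surjective φ
  obtain ⟨κ, hκ⟩ := h.exists_lift g.hom
  have hg : g = ModuleCat.ofHom (LinearMap.mulLeft R κ) ≫ S.g := by
    ext y
    exact hκ y
  rw [hg, Abelian.Ext.homEquiv₀_symm_apply, ← Abelian.Ext.mk₀_comp_mk₀,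
    Abelian.Ext.comp_assoc (a₁₂ := 0) (a₂₃ := 1) _ _ _ (by lia) (by lia) (by lia),
    hS.comp_extClass, Abelian.Ext.comp_zero]

/-! ### Descent along integral extensions with a retraction -/

/-- Completeness passes from `A` to `R` if `A` has an `R`-linear retraction `ρ` onto `R` and
every non-zero element of `A` divides one of `R`: a coherent family of `R` extends to `A`, and
`ρ` maps its limit to the limit in `R`. -/
theorem IsDvdComplete.of_retraction {R A : Type*} [CommRing R] [IsDomain R] [CommRing A]
    [Algebra R A] (hdvd : ∀ a : A, a ≠ 0 → ∃ r : R, r ≠ 0 ∧ a ∣ algebraMap R A r)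
    (ρ : A →ₗ[R] R) (hρ : ρ 1 = 1) (h : IsDvdComplete A) :
    IsDvdComplete R := by
  intro x hx
  have hρ' : ∀ s : R, ρ (algebraMap R A s) = s := fun s ↦ by
    rw [Algebra.algebraMap_eq_smul_one, map_smul, hρ, smul_eq_mul, mul_one]
  have hdvd' : ∀ a : A, ∃ r : R, a ≠ 0 → r ≠ 0 ∧ a ∣ algebraMap R A r := by
    intro a
    by_cases ha : a = 0
    · exact ⟨0, fun h ↦ (h ha).elim⟩
    · obtain ⟨r, hr⟩ := hdvd a ha
      exact ⟨r, fun _ ↦ hr⟩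
  choose m hm using hdvd'
  obtain ⟨r', hr'⟩ := h (fun a ↦ algebraMap R A (x (m a))) (by
    intro s t ht hst
    by_cases hs : s = 0
    · subst hs
      exact (ht (zero_dvd_iff.mp hst)).elim
    have h0 : m s * m t ≠ 0 := mul_ne_zero (hm s hs).1 (hm t ht).1
    have h1 := map_dvd (algebraMap R A) (hx h0 (Dvd.intro _ rfl : m s ∣ m s * m t))
    have h2 := map_dvd (algebraMap R A) (hx h0 (Dvd.intro_left _ rfl : m t ∣ m s * m t))
    have h3 := dvd_sub ((hm s hs).2.trans h1) ((hst.trans (hm t ht).2).trans h2)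
    simpa [map_sub] using h3)
  refine ⟨ρ r', fun s hs ↦ ?_⟩
  have hs' : algebraMap R A s ≠ 0 := fun h0 ↦ hs (by rw [← hρ' s, h0, map_zero])
  have key : algebraMap R A s ∣ algebraMap R A (x s) - r' := by
    have h0 : s * m (algebraMap R A s) ≠ 0 := mul_ne_zero hs (hm _ hs').1
    have h1 := map_dvd (algebraMap R A) (hx h0 (Dvd.intro _ rfl : s ∣ _))
    have h2 := map_dvd (algebraMap R A) (hx h0 (Dvd.intro_left _ rfl : m (algebraMap R A s) ∣ _))
    have h3 := dvd_sub ((hm _ hs').2.trans h2) h1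
    have h4 := dvd_add h3 (hr' _ hs')
    simp only [map_sub] at h4
    convert h4 using 1
    ring
  obtain ⟨c, hc⟩ := key
  refine ⟨ρ c, ?_⟩
  have := congrArg ρ hc
  rwa [map_sub, ← Algebra.smul_def, map_smul, hρ'] at this

/-! ### Hankel dependence and points outside countably many hypersurfaces -/

/-- If no non-trivial combination of the `m` columns of `M` vanishes, then `M` has a non-zero minor
of size `m`. By induction: with a non-zero minor `δ` of the columns other than the first one,
expanding along an extra row gives a combination of the columns in which the first one has the
coefficient `δ`. -/
theorem exists_det_ne_zero_of_columns {A ι : Type*} [CommRing A] [Nontrivial A] :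
    ∀ {m : ℕ} (M : ι → Fin m → A), (∀ q : Fin m → A, (∀ d, ∑ j, M d j * q j = 0) → q = 0) →
      ∃ e : Fin m → ι, (Matrix.of fun i j ↦ M (e i) j).det ≠ 0 := by
  intro m
  induction m with
  | zero => intro M _; exact ⟨Fin.elim0, by simp⟩
  | succ m ih =>
    intro M hM
    obtain ⟨e, he⟩ := ih (fun d j ↦ M d j.succ) (by
      intro q hq
      have := hM (Fin.cons 0 q) (fun d ↦ by simpa [Fin.sum_univ_succ] using hq d)
      funext j
      simpa using congrFun this j.succ)
    by_contra! hdet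
    have := hM (fun j ↦ (-1) ^ (j : ℕ) * (Matrix.of fun a b ↦ M (e a) (j.succAbove b)).det) (by
      intro d
      rw [← hdet (Fin.cons d e), Matrix.det_succ_row_zero]
      refine Finset.sum_congr rfl fun j _ ↦ ?_
      rw [mul_left_comm, ← mul_assoc]
      rfl)
    exact he (by simpa using congrFun this 0)

/-- Over an uncountable field, countably many hypersurfaces do not cover affine space. -/
theorem exists_forall_eval_ne_zero {k : Type*} [Field k] [Uncountable k] :
    ∀ {n : ℕ} (g : ℕ → MvPolynomial (Fin n) k), (∀ i, g i ≠ 0) →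
      ∃ a : Fin n → k, ∀ i, MvPolynomial.eval a (g i) ≠ 0 := by
  intro n
  induction n with
  | zero =>
    intro g hg
    refine ⟨Fin.elim0, fun i h ↦ hg i ?_⟩
    rw [MvPolynomial.eq_C_of_isEmpty (g i)] at h ⊢
    rw [MvPolynomial.eval_C] at h
    rw [h, map_zero]
  | succ n ih =>
    intro g hg
    let G : ℕ → Polynomial (MvPolynomial (Fin n) k) := fun i ↦ MvPolynomial.finSuccEquiv k n (g i)
    have hG : ∀ i, G i ≠ 0 := fun i ↦ by simpa [G] using hg i
    obtain ⟨a, ha⟩ := ih (fun i ↦ (G i).leadingCoeff) (fun i ↦ by simpa using hG i)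
    have hne : ∀ i, (G i).map (MvPolynomial.eval a) ≠ 0 := fun i h ↦ ha i (by
      have := congrArg (fun p ↦ p.coeff (G i).natDegree) h
      simpa [Polynomial.coeff_map] using this)
    have hc : (⋃ i, {y | ((G i).map (MvPolynomial.eval a)).IsRoot y}).Countable :=
      Set.countable_iUnion fun i ↦ (Polynomial.finite_setOfPred_isRoot (hne i)).countable
    obtain ⟨y, hy⟩ := (Set.ne_univ_iff_exists_notMem _).mp
      (fun h ↦ Set.not_countable_univ (α := k) (h ▸ hc))
    refine ⟨Fin.cons y a, fun i h ↦ hy (Set.mem_iUnion.mpr ⟨i, ?_⟩)⟩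
    rw [MvPolynomial.eval_eq_eval_mv_eval'] at h
    exact h

/-- If at every point the sequence of values of the `F d` satisfies a linear recurrence, then the
sequence `F` itself satisfies one with polynomial coefficients. Otherwise there are non-zero Hankel
minors of `F` of every size, and at a point where none of them vanishes there is no recurrence. -/
theorem exists_recurrence {k : Type*} [Field k] [Uncountable k] {n : ℕ}
    (F : ℕ → MvPolynomial (Fin n) k)
    (h : ∀ a : Fin n → k, ∃ (m : ℕ) (u : Fin m → k), u ≠ 0 ∧
      ∀ d : ℕ, ∑ j : Fin m, MvPolynomial.eval a (F (d + j)) * u j = 0) :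
    ∃ (m : ℕ) (q : Fin m → MvPolynomial (Fin n) k), q ≠ 0 ∧
      ∀ d : ℕ, ∑ j : Fin m, F (d + j) * q j = 0 := by
  by_contra! hcon
  have hM : ∀ m : ℕ, ∃ e : Fin m → ℕ, (Matrix.of fun (i j : Fin m) ↦ F (e i + j)).det ≠ 0 :=
    fun m ↦ exists_det_ne_zero_of_columns (fun d (j : Fin m) ↦ F (d + j)) fun q hq ↦ by
      by_contra hq0
      obtain ⟨d, hd⟩ := hcon m q hq0
      exact hd (hq d)
  choose e he using hM
  obtain ⟨a, ha⟩ := exists_forall_eval_ne_zero _ he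
  obtain ⟨m, u, hu, hrec⟩ := h a
  refine ha m ?_
  rw [RingHom.map_det]
  exact Matrix.exists_mulVec_eq_zero_iff.mp ⟨u, hu, funext fun i ↦ hrec (e m i)⟩

/-! ### The expansion along the lines through a point -/

section Dilation

open MvPolynomial

variable {σ k : Type*} [Field k]

/-- The homomorphism `g(X) ↦ g(T X)` from `k[X]` to `k[X]⟦T⟧`. -/
noncomputable def dilation (σ k : Type*) [Field k] :
    MvPolynomial σ k →+* PowerSeries (MvPolynomial σ k) :=
  eval₂Hom (PowerSeries.C.comp C) fun i ↦ PowerSeries.C (X i) * PowerSeries.X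

theorem dilation_monomial (α : σ →₀ ℕ) (c : k) :
    dilation σ k (monomial α c) = PowerSeries.C (monomial α c) * PowerSeries.X ^ α.degree := by
  rw [dilation, coe_eval₂Hom, eval₂_monomial, monomial_eq, map_mul, RingHom.comp_apply, mul_assoc]
  congr 1
  simp only [Finsupp.prod, mul_pow, Finset.prod_mul_distrib, map_prod, map_pow,
    Finset.prod_pow_eq_pow_sum, Finsupp.degree_apply]

theorem coeff_dilation (g : MvPolynomial σ k) (d : ℕ) :
    PowerSeries.coeff d (dilation σ k g) = homogeneousComponent d g := by
  induction g using MvPolynomial.induction_on' with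
  | monomial α c =>
    rw [dilation_monomial, PowerSeries.coeff_C_mul, PowerSeries.coeff_X_pow,
      homogeneousComponent_of_mem (isHomogeneous_monomial c rfl)]
    simp
  | add p q hp hq => rw [map_add, map_add, map_add, hp, hq]

theorem dilation_of_isHomogeneous {h : MvPolynomial σ k} {d : ℕ} (hh : h.IsHomogeneous d) :
    dilation σ k h = PowerSeries.C h * PowerSeries.X ^ d := by
  ext1 e
  rw [coeff_dilation, PowerSeries.coeff_C_mul, PowerSeries.coeff_X_pow,
    homogeneousComponent_of_mem hh]
  simp

theorem dilation_injective : Function.Injective (dilation σ k) := by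
  rw [injective_iff_map_eq_zero]
  intro g hg
  rw [← sum_homogeneousComponent g]
  exact Finset.sum_eq_zero fun d _ ↦ by rw [← coeff_dilation, hg, map_zero]

theorem homogeneousComponent_mul_of_isHomogeneous {h : MvPolynomial σ k} {a : ℕ}
    (hh : h.IsHomogeneous a) (g : MvPolynomial σ k) (b : ℕ) :
    homogeneousComponent b (h * g) = if a ≤ b then h * homogeneousComponent (b - a) g else 0 := by
  rw [← coeff_dilation, map_mul, dilation_of_isHomogeneous hh, mul_assoc, PowerSeries.coeff_C_mul,
    PowerSeries.coeff_X_pow_mul', coeff_dilation]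
  simp

theorem coeff_zero_ne_zero_of_isUnit_dilation {u : MvPolynomial σ k}
    (hu : IsUnit (dilation σ k u)) : coeff 0 u ≠ 0 := by
  have h := hu.map (PowerSeries.constantCoeff (R := MvPolynomial σ k))
  rw [← PowerSeries.coeff_zero_eq_constantCoeff_apply, coeff_dilation,
    homogeneousComponent_zero] at h
  rintro h0
  rw [h0, map_zero] at h
  exact not_isUnit_zero h

/-- Power series with coefficients homogeneous of the same degree as the power of `T` are stable
under division. -/
theorem isHomogeneous_coeff_of_mul_dilation {b : PowerSeries (MvPolynomial σ k)}
    {g u : MvPolynomial σ k} (hu : coeff 0 u ≠ 0) (h : b * dilation σ k u = dilation σ k g) (d : ℕ) :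
    (PowerSeries.coeff d b).IsHomogeneous d := by
  induction d using Nat.strong_induction_on with
  | _ d ih =>
    have hd := congrArg (PowerSeries.coeff d) h
    rw [PowerSeries.coeff_mul, Finset.Nat.sum_antidiagonal_eq_sum_range_succ_mk,
      Finset.sum_range_succ, coeff_dilation] at hd
    simp only [coeff_dilation, Nat.sub_self, homogeneousComponent_zero] at hd
    have h1 : PowerSeries.coeff d b = (homogeneousComponent d g - ∑ i ∈ Finset.range d,
        PowerSeries.coeff i b * homogeneousComponent (d - i) u) * C (coeff 0 u)⁻¹ := by
      rw [← hd, add_sub_cancel_left, mul_assoc, ← map_mul, mul_inv_cancel₀ hu, map_one, mul_one]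
    rw [h1]
    refine IsHomogeneous.mul (n := 0) (((homogeneousComponent_isHomogeneous d g)).sub
      (IsHomogeneous.sum _ _ _ fun i hi ↦ ?_)) (isHomogeneous_C _ _)
    have hi := Finset.mem_range.mp hi
    have := (ih i hi).mul (homogeneousComponent_isHomogeneous (d - i) u)
    rwa [Nat.add_sub_cancel' hi.le] at this

/-- There is a hyperplane through the origin in any given direction. -/
theorem exists_linear_form {n : ℕ} (hn : 2 ≤ n) (a : Fin n → k) :
    ∃ ℓ : MvPolynomial (Fin n) k, ℓ.IsHomogeneous 1 ∧ ℓ ≠ 0 ∧ eval a ℓ = 0 := by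
  let i₀ : Fin n := ⟨0, by lia⟩
  let i₁ : Fin n := ⟨1, by lia⟩
  have h01 : i₀ ≠ i₁ := by simp [i₀, i₁]
  by_cases h : a i₀ = 0
  · exact ⟨X i₀, isHomogeneous_X k i₀, X_ne_zero _, by simpa using h⟩
  · refine ⟨C (a i₁) * X i₀ - C (a i₀) * X i₁,
      (isHomogeneous_C_mul_X _ _).sub (isHomogeneous_C_mul_X _ _), fun h0 ↦ h ?_,
      by simp [mul_comm]⟩
    have := congrArg (coeff (Finsupp.single i₁ 1)) h0
    simpa [coeff_C_mul, coeff_X, Finsupp.single_left_inj, h01] using this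

theorem irreducible_of_isHomogeneous_one {ℓ : MvPolynomial σ k} (hℓ : ℓ.IsHomogeneous 1)
    (h0 : ℓ ≠ 0) : Irreducible ℓ := by
  refine irreducible_of_totalDegree_eq_one (hℓ.totalDegree h0) fun x hx ↦ ?_
  obtain ⟨α, hα⟩ := ne_zero_iff.mp h0
  exact (ne_zero_of_dvd_ne_zero hα (hx α)).isUnit

/-- A linear recurrence for the values at `a` of the coefficients of a quotient of polynomials. -/
theorem exists_recurrence_of_mul_dilation {F : ℕ → k} {g u : MvPolynomial σ k} (a : σ → k)
    (hu : coeff 0 u ≠ 0)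
    (h : PowerSeries.mk F * (dilation σ k u).map (eval a) = (dilation σ k g).map (eval a)) :
    ∃ (m : ℕ) (v : Fin m → k), v ≠ 0 ∧ ∀ d : ℕ, ∑ j : Fin m, F (d + j) * v j = 0 := by
  let N := max g.totalDegree u.totalDegree
  refine ⟨N + 2, fun j ↦ eval a (homogeneousComponent (N + 1 - j) u), fun h0 ↦ hu ?_, fun d ↦ ?_⟩
  · simpa [homogeneousComponent_zero] using congrFun h0 (Fin.last _)
  · have hd := congrArg (PowerSeries.coeff (N + 1 + d)) h
    rw [PowerSeries.coeff_map, coeff_dilation, homogeneousComponent_eq_zero, map_zero,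
      PowerSeries.coeff_mul, Finset.Nat.sum_antidiagonal_eq_sum_range_succ_mk] at hd
    · simp only [PowerSeries.coeff_mk, PowerSeries.coeff_map, coeff_dilation] at hd
      have hlow : ∀ i ∈ Finset.range d,
          F i * eval a (homogeneousComponent (N + 1 + d - i) u) = 0 := fun i hi ↦ by
        have hi := Finset.mem_range.mp hi
        rw [homogeneousComponent_eq_zero _ u (by lia), map_zero, mul_zero]
      rw [show (N + 1 + d).succ = d + (N + 2) by lia, Finset.sum_range_add _ d,
        Finset.sum_eq_zero hlow, zero_add] at hd
      rw [Fin.sum_univ_eq_sum_range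
        (fun j ↦ F (d + j) * eval a (homogeneousComponent (N + 1 - j) u)), ← hd]
      exact Finset.sum_congr rfl fun j _ ↦ by
        rw [show N + 1 + d - (d + j) = N + 1 - j by lia]
    · lia

/-- A recurrence for a sequence of forms `F d` of degree `d` may be taken homogeneous; its
coefficients then are the homogeneous components of a denominator of `∑ F d`. -/
theorem exists_mul_dilation_of_recurrence {F : ℕ → MvPolynomial σ k}
    (hF : ∀ d, (F d).IsHomogeneous d) {m : ℕ} {q : Fin m → MvPolynomial σ k} (hq : q ≠ 0)
    (h : ∀ d : ℕ, ∑ j : Fin m, F (d + j) * q j = 0) :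
    ∃ Q P : MvPolynomial σ k, Q ≠ 0 ∧ dilation σ k Q * PowerSeries.mk F = dilation σ k P := by
  obtain ⟨j₀, hj₀⟩ := Function.ne_iff.mp hq
  have : ∃ e, homogeneousComponent e (q j₀) ≠ 0 := by
    by_contra! h0
    exact hj₀ (by rw [← sum_homogeneousComponent (q j₀)]; exact Finset.sum_eq_zero fun e _ ↦ h0 e)
  obtain ⟨e, he⟩ := this
  -- `q'` collects the coefficients of the degree `c + d` part of the recurrence at `d`: as `F (d + j)`
  -- has degree `d + j`, the component of `q j` that enters has degree `c - j`, whatever `d` is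
  let c := e + j₀
  let q' : Fin m → MvPolynomial σ k := fun j ↦
    if (j : ℕ) ≤ c then homogeneousComponent (c - j) (q j) else 0
  have hq' : ∀ d : ℕ, ∑ j : Fin m, F (d + j) * q' j = 0 := by
    intro d
    have := congrArg (homogeneousComponent (c + d)) (h d)
    rw [map_sum, map_zero] at this
    rw [← this]
    refine Finset.sum_congr rfl fun j _ ↦ ?_
    rw [homogeneousComponent_mul_of_isHomogeneous (hF _)]
    by_cases hj : (j : ℕ) ≤ c
    · simp only [q', if_pos hj, if_pos (show d + (j : ℕ) ≤ c + d by lia),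
        show c + d - (d + (j : ℕ)) = c - j by lia]
    · simp only [q', if_neg hj, if_neg (show ¬ d + (j : ℕ) ≤ c + d by lia), mul_zero]
  have hdil : dilation σ k (∑ j, q' j) =
      ∑ j, PowerSeries.C (q' j) * PowerSeries.X ^ (c - (j : ℕ)) := by
    rw [map_sum]
    refine Finset.sum_congr rfl fun j _ ↦ ?_
    by_cases hj : (j : ℕ) ≤ c
    · simp only [q', if_pos hj]
      exact dilation_of_isHomogeneous (homogeneousComponent_isHomogeneous _ _)
    · simp only [q', if_neg hj, map_zero, zero_mul]
  let G := dilation σ k (∑ j, q' j) * PowerSeries.mk F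
  have hG : ∀ d, (PowerSeries.coeff d G).IsHomogeneous d := by
    intro d
    rw [PowerSeries.coeff_mul]
    refine IsHomogeneous.sum _ _ _ fun i hi ↦ ?_
    rw [coeff_dilation, PowerSeries.coeff_mk, ← Finset.HasAntidiagonal.mem_antidiagonal.mp hi]
    exact (homogeneousComponent_isHomogeneous _ _).mul (hF _)
  have hG0 : ∀ d, PowerSeries.coeff (c + d) G = 0 := by
    intro d
    simp only [G, hdil, Finset.sum_mul, map_sum]
    rw [← hq' d]
    refine Finset.sum_congr rfl fun j _ ↦ ?_
    rw [mul_assoc, PowerSeries.coeff_C_mul, PowerSeries.coeff_X_pow_mul', if_pos (by lia),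
      PowerSeries.coeff_mk]
    by_cases hj : (j : ℕ) ≤ c
    · rw [show c + d - (c - (j : ℕ)) = d + j by lia, mul_comm]
    · simp only [q', if_neg hj, mul_zero, zero_mul]
  refine ⟨∑ j, q' j, ∑ d ∈ Finset.range c, PowerSeries.coeff d G, fun h0 ↦ he ?_, ?_⟩
  · have := congrArg (homogeneousComponent e) h0
    rw [map_zero, map_sum, Finset.sum_eq_single j₀] at this
    · simpa [q', c, homogeneousComponent_of_mem (homogeneousComponent_isHomogeneous e (q j₀))]
        using this
    · intro j _ hj
      have hj : (j : ℕ) ≠ j₀ := fun h ↦ hj (Fin.ext h)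
      by_cases hjc : (j : ℕ) ≤ c
      · simp only [q', if_pos hjc]
        rw [homogeneousComponent_of_mem (homogeneousComponent_isHomogeneous _ _),
          if_neg (by lia)]
      · simp only [q', if_neg hjc, map_zero]
    · simp
  · ext1 d
    change PowerSeries.coeff d G = _
    rw [coeff_dilation, map_sum]
    simp only [homogeneousComponent_of_mem (hG _)]
    by_cases hd : d < c
    · simp [hd]
    · rw [Finset.sum_ite_eq, if_neg (by simpa using hd), ← Nat.add_sub_cancel' (not_lt.mp hd), hG0]

/-- Let `x` be a coherent family in a ring `R` of fractions of `k[X]`, expanded in `k[X]⟦T⟧` by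
`φ`. It has a limit there, a series `∑ F d T ^ d` whose values along each line through the origin
are a rational function, since the line lies in a hyperplane `ℓ = 0`, where `x ℓ` gives
that function. By `exists_recurrence` the series is a fraction `p / q`, hence `q • x` and `p` agree
up to all powers of the ideal of the origin. -/
theorem IsDvdCoherent.exists_fraction {R : Type*} [CommRing R] [IsDomain R] [Uncountable k]
    {n : ℕ} (hn : 2 ≤ n) (j : MvPolynomial (Fin n) k →+* R)
    (φ : R →+* PowerSeries (MvPolynomial (Fin n) k)) (hφ : ∀ g, φ (j g) = dilation (Fin n) k g)
    (hfrac : ∀ r, ∃ g u, IsUnit (j u) ∧ r * j u = j g) {x : R → R} (hx : IsDvdCoherent x) :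
    ∃ q p : R, q ≠ 0 ∧ ∀ s ≠ 0, ∀ D, ∃ z, s ∣ z - x s ∧
      q * z - p ∈ Ideal.map j (idealOfVars (Fin n) k) ^ D := by
  have hinj : Function.Injective j := fun g g' h ↦ dilation_injective (by rw [← hφ, h, hφ])
  have hunit : ∀ u, IsUnit (j u) → coeff 0 u ≠ 0 := fun u hu ↦
    coeff_zero_ne_zero_of_isUnit_dilation (by rw [← hφ]; exact hu.map φ)
  let X₀ : MvPolynomial (Fin n) k := X ⟨0, by lia⟩
  have hX₀ : j X₀ ≠ 0 := by
    rw [Ne, map_eq_zero_iff j hinj]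
    exact X_ne_zero _
  -- `x s` determines the coefficient of `T ^ d` once `s` lies in the power `d + 1` of the ideal of
  -- the origin
  let F : ℕ → MvPolynomial (Fin n) k := fun d ↦ PowerSeries.coeff d (φ (x (j X₀ ^ (d + 1))))
  have hF : ∀ d, (F d).IsHomogeneous d := fun d ↦ by
    obtain ⟨g, u, hu, h⟩ := hfrac (x (j X₀ ^ (d + 1)))
    refine isHomogeneous_coeff_of_mul_dilation (g := g) (hunit u hu) ?_ d
    rw [← hφ, ← map_mul, h, hφ]
  have hlim : ∀ s ≠ 0, ∀ D, ∃ z, s ∣ z - x s ∧ ∀ d < D, PowerSeries.coeff d (φ z) = F d := by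
    intro s hs D
    have h0 : s * j X₀ ^ D ≠ 0 := mul_ne_zero hs (pow_ne_zero _ hX₀)
    refine ⟨x (s * j X₀ ^ D), hx h0 (Dvd.intro _ rfl), fun d hd ↦ ?_⟩
    have h1 := hx h0 ((pow_dvd_pow (j X₀) (Nat.succ_le_of_lt hd)).trans (Dvd.intro_left _ rfl))
    have h2 : PowerSeries.X ^ (d + 1) ∣ φ (j X₀ ^ (d + 1)) := by
      rw [map_pow, hφ, dilation_of_isHomogeneous (isHomogeneous_X k _), pow_one]
      exact pow_dvd_pow_of_dvd (Dvd.intro_left _ rfl) _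
    have h3 := PowerSeries.X_pow_dvd_iff.mp (h2.trans (map_dvd φ h1)) d (Nat.lt_succ_self d)
    rwa [map_sub, map_sub, sub_eq_zero] at h3
  -- evaluation at `a` kills `φ (j ℓ) = ℓ T`, so there the limit is the expansion of `x (j ℓ)`
  obtain ⟨m, q, hq, hrec⟩ := exists_recurrence F (fun a ↦ by
    obtain ⟨ℓ, hℓhom, hℓ0, hℓa⟩ := exists_linear_form hn a
    rw [Ne, ← map_eq_zero_iff j hinj] at hℓ0
    obtain ⟨g, u, hu, h⟩ := hfrac (x (j ℓ))
    refine exists_recurrence_of_mul_dilation (F := fun d ↦ eval a (F d)) (g := g) a (hunit u hu) ?_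
    have hFx : (PowerSeries.mk fun d ↦ eval a (F d)) = (φ (x (j ℓ))).map (eval a) := by
      ext d
      obtain ⟨z, ⟨w, hw⟩, hz⟩ := hlim _ hℓ0 (d + 1)
      have h1 : (φ (z - x (j ℓ))).map (eval a) = 0 := by
        rw [hw, map_mul, map_mul, hφ, dilation_of_isHomogeneous hℓhom, map_mul, PowerSeries.map_C,
          hℓa, map_zero, zero_mul, zero_mul]
      rw [map_sub, map_sub, sub_eq_zero] at h1
      rw [PowerSeries.coeff_mk, ← hz d (Nat.lt_succ_self d), ← h1, PowerSeries.coeff_map]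
    rw [hFx, ← map_mul, ← hφ, ← map_mul, h, hφ])
  obtain ⟨Q, P, hQ, hQP⟩ := exists_mul_dilation_of_recurrence hF hq hrec
  refine ⟨j Q, j P, by rwa [Ne, map_eq_zero_iff j hinj], fun s hs D ↦ ?_⟩
  obtain ⟨z, hzs, hz⟩ := hlim s hs D
  refine ⟨z, hzs, ?_⟩
  -- the expansion of `Q z - P` is divisible by `T ^ D`, hence so is that of its numerator `g`
  obtain ⟨g, u, ⟨w, hw⟩, h⟩ := hfrac (j Q * z - j P)
  have h1 : PowerSeries.X ^ D ∣ φ (j Q * z - j P) := by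
    have : PowerSeries.X ^ D ∣ φ z - PowerSeries.mk F :=
      PowerSeries.X_pow_dvd_iff.mpr fun d hd ↦ by
        rw [map_sub, hz d hd, PowerSeries.coeff_mk, sub_self]
    rw [map_sub, map_mul, hφ, hφ, ← hQP, ← mul_sub]
    exact this.mul_left _
  have h2 : g ∈ idealOfVars (Fin n) k ^ D := by
    rw [mem_pow_idealOfVars_iff']
    intro α hα
    have h3 : PowerSeries.X ^ D ∣ dilation (Fin n) k g := by
      rw [← hφ, ← h, map_mul]
      exact h1.mul_right _
    have h4 := PowerSeries.X_pow_dvd_iff.mp h3 _ hα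
    rw [coeff_dilation] at h4
    have h5 := congrArg (coeff α) h4
    rwa [coeff_homogeneousComponent, if_pos rfl, coeff_zero] at h5
  have h3 : j Q * z - j P = j g * ↑w⁻¹ := by
    rw [Units.eq_mul_inv_iff_mul_eq, hw, h]
  rw [h3, ← Ideal.map_pow]
  exact Ideal.mul_mem_right _ _ (Ideal.mem_map_of_mem j h2)

end Dilation

/-! ### From one maximal ideal to all -/

/-- Krull's intersection theorem in `R ⧸ sR`. -/
theorem exists_mem_dvd_one_sub_mul {R : Type*} [CommRing R] [IsNoetherianRing R] (I : Ideal R)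
    {s y : R} (h : ∀ D : ℕ, ∃ z, s ∣ z - y ∧ z ∈ I ^ D) : ∃ r ∈ I, s ∣ (1 - r) * y := by
  let S := Ideal.span {s}
  have hmem : Ideal.Quotient.mk S y ∈ (⨅ i : ℕ, I ^ i • ⊤ : Submodule R (R ⧸ S)) := by
    rw [Submodule.mem_iInf]
    intro D
    obtain ⟨z, hz, hzI⟩ := h D
    have h1 : Ideal.Quotient.mk S y = z • (1 : R ⧸ S) := by
      rw [Algebra.smul_def, mul_one]
      exact ((Ideal.Quotient.eq).mpr (Ideal.mem_span_singleton.mpr hz)).symm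
    rw [h1]
    exact Submodule.smul_mem_smul hzI trivial
  obtain ⟨⟨r, hr⟩, hry⟩ := (I.mem_iInf_smul_pow_eq_bot_iff _).mp hmem
  refine ⟨r, hr, Ideal.mem_span_singleton.mp (Ideal.Quotient.eq_zero_iff_mem.mp ?_)⟩
  rw [Algebra.smul_def] at hry
  rw [map_mul, map_sub, map_one, sub_mul, one_mul, sub_eq_zero]
  exact hry.symm

/-- A coherent family `y` that vanishes locally at the maximal ideal `m` vanishes, if any other
maximal ideal `m'` shares a prime element `f` with `m`. Indeed `f ^ N` divides `y (f ^ N)`, as `f`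
lies in `m`, so `y s` lies in `(s, f ^ N)` for all `N`, hence vanishes modulo `s` locally at `m'`. -/
theorem IsDvdCoherent.dvd_of_locally {R : Type*} [CommRing R] [IsDomain R] [IsNoetherianRing R]
    {y : R → R} (hy : IsDvdCoherent y) (m : Ideal R)
    (hprime : ∀ m' : Ideal R, m'.IsMaximal → ∃ f, Prime f ∧ f ∈ m ∧ f ∈ m')
    (h : ∀ s ≠ 0, ∃ g ∉ m, s ∣ g * y s) : ∀ s ≠ 0, s ∣ y s := by
  intro s hs
  -- the annihilator of the class of `y s` in `R ⧸ sR`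
  let J : Ideal R := Submodule.comap (LinearMap.mulRight R (y s)) (Ideal.span {s})
  have hJ : ∀ g, g ∈ J ↔ s ∣ g * y s := fun g ↦ Ideal.mem_span_singleton
  suffices J = ⊤ by simpa using (hJ 1).mp (this ▸ trivial)
  by_contra hne
  obtain ⟨m', hm', hJm'⟩ := Ideal.exists_le_maximal J hne
  obtain ⟨f, hf, hfm, hfm'⟩ := hprime m' hm'
  have hpow : ∀ N, f ^ N ∣ y (f ^ N) := fun N ↦ by
    obtain ⟨g, hg, hdvd⟩ := h (f ^ N) (pow_ne_zero _ hf.ne_zero)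
    exact hf.pow_dvd_of_dvd_mul_left N (fun hfg ↦ hg (m.mem_of_dvd hfg hfm)) hdvd
  obtain ⟨r, hr, hrs⟩ := exists_mem_dvd_one_sub_mul (Ideal.span {f}) (s := s) (y := y s) fun D ↦ by
    have h0 : s * f ^ D ≠ 0 := mul_ne_zero hs (pow_ne_zero _ hf.ne_zero)
    refine ⟨y (s * f ^ D), hy h0 (Dvd.intro _ rfl), ?_⟩
    rw [Ideal.span_singleton_pow, Ideal.mem_span_singleton]
    exact (dvd_iff_dvd_of_dvd_sub (hy h0 (Dvd.intro_left _ rfl))).mpr (hpow D)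
  have h1 : 1 - r ∈ m' := hJm' ((hJ _).mpr hrs)
  have h2 : r ∈ m' := (Ideal.span_singleton_le_iff_mem m').mpr hfm' hr
  exact hm'.ne_top ((Ideal.eq_top_iff_one _).mpr (by simpa using add_mem h1 h2))

/-- A coherent family that is a fraction `p / q` of `R` is constant. -/
theorem IsDvdCoherent.exists_of_dvd_mul_sub {R : Type*} [CommRing R] [IsDomain R]
    {x : R → R} (hx : IsDvdCoherent x) {p q : R} (hq : q ≠ 0) (h : ∀ s ≠ 0, s ∣ q * x s - p) :
    ∃ r, ∀ s ≠ 0, s ∣ x s - r := by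
  obtain ⟨r, rfl⟩ : q ∣ p := (dvd_sub_right (Dvd.intro _ rfl)).mp (h q hq)
  refine ⟨r, fun s hs ↦ ?_⟩
  have h0 := mul_ne_zero hq hs
  have h1 := h (q * s) h0
  rw [← mul_sub, mul_dvd_mul_iff_left hq] at h1
  have h2 := dvd_sub h1 (hx h0 (Dvd.intro_left _ rfl : s ∣ q * s))
  simpa using h2

/-! ### Algebraically closed fields -/

section Translation

open MvPolynomial

variable {σ k : Type*} [Field k]

/-- The substitution `X ↦ X + a`. -/
noncomputable def translation (a : σ → k) : MvPolynomial σ k ≃ₐ[k] MvPolynomial σ k :=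
  AlgEquiv.ofAlgHom (aeval fun i ↦ X i + C (a i)) (aeval fun i ↦ X i - C (a i))
    (by ext; simp) (by ext; simp)

theorem eval_translation_symm (a b : σ → k) (g : MvPolynomial σ k) :
    eval b ((translation a).symm g) = eval (b - a) g := by
  have : (eval b).comp (translation a).symm.toAlgHom.toRingHom = eval (b - a) := by
    ext i <;> simp [translation]
  exact congrArg (fun f ↦ f g) this

theorem eval_translation (a b : σ → k) (g : MvPolynomial σ k) :
    eval b (translation a g) = eval (b + a) g := by
  rw [← add_sub_cancel_right b a, ← eval_translation_symm, AlgEquiv.symm_apply_apply,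
    sub_add_cancel]

/-- Two points lie on a common hyperplane, here irreducible as the zero locus of a prime. -/
theorem exists_prime_eval_eq_zero {n : ℕ} (hn : 2 ≤ n) (a b : Fin n → k) :
    ∃ f : MvPolynomial (Fin n) k, Prime f ∧ eval a f = 0 ∧ eval b f = 0 := by
  obtain ⟨ℓ, hℓ, hℓ0, hℓb⟩ := exists_linear_form hn (b - a)
  refine ⟨(translation a).symm ℓ, ?_, ?_, ?_⟩
  · exact (MulEquiv.prime_iff (translation a).symm.toMulEquiv).mpr
      (irreducible_of_isHomogeneous_one hℓ hℓ0).prime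
  · rw [eval_translation_symm, sub_self, eval_zero, constantCoeff_eq]
    exact hℓ.coeff_eq_zero (by simp)
  · rw [eval_translation_symm, hℓb]

/-- Over an uncountable algebraically closed field: at one maximal ideal `m`, a rational
point, a coherent family is a fraction `p / q`; any other maximal ideal lies with `m` on a
hyperplane, which propagates this to all of `R`. -/
theorem isDvdComplete_of_isAlgClosed [IsAlgClosed k] [Uncountable k] {n : ℕ} (hn : 2 ≤ n)
    (U : Submonoid (MvPolynomial (Fin n) k)) (hU : (0 : MvPolynomial (Fin n) k) ∉ U)
    (R : Type*) [CommRing R] [Algebra (MvPolynomial (Fin n) k) R] [IsLocalization U R]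
    (hmax : ∀ m : Ideal R, m.IsMaximal →
      (m.comap (algebraMap (MvPolynomial (Fin n) k) R)).IsMaximal) : IsDvdComplete R := by
  have : IsDomain R := IsLocalization.isDomain_of_le_nonZeroDivisors _
    (le_nonZeroDivisors_of_noZeroDivisors hU)
  have : IsNoetherianRing R := IsLocalization.isNoetherianRing U R inferInstance
  have hpt : ∀ m : Ideal R, m.IsMaximal → ∃ a : Fin n → k,
      ∀ g, algebraMap (MvPolynomial (Fin n) k) R g ∈ m ↔ eval a g = 0 := fun m hm ↦ by
    obtain ⟨a, ha⟩ := isMaximal_iff_eq_vanishingIdeal_singleton.mp (hmax m hm)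
    refine ⟨a, fun g ↦ ?_⟩
    rw [← Ideal.mem_comap, ha, mem_vanishingIdeal_singleton_iff, ← coe_aeval_eq_eval]
    rfl
  intro x hx
  obtain ⟨m, hm⟩ := Ideal.exists_maximal R
  obtain ⟨a, ha⟩ := hpt m hm
  have hUm : ∀ m' : Ideal R, m'.IsMaximal → ∀ u ∈ U,
      algebraMap (MvPolynomial (Fin n) k) R u ∉ m' := fun m' hm' u hu h ↦
    hm'.ne_top (m'.eq_top_of_isUnit_mem h (IsLocalization.map_units R ⟨u, hu⟩))
  let j : MvPolynomial (Fin n) k →+* R :=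
    (algebraMap (MvPolynomial (Fin n) k) R).comp (translation a).symm.toAlgHom.toRingHom
  have hj : ∀ g, j g = algebraMap (MvPolynomial (Fin n) k) R ((translation a).symm g) :=
    fun _ ↦ rfl
  let ψ : MvPolynomial (Fin n) k →+* PowerSeries (MvPolynomial (Fin n) k) :=
    (dilation (Fin n) k).comp (translation a).toAlgHom.toRingHom
  have hψ : ∀ g, ψ g = dilation (Fin n) k (translation a g) := fun _ ↦ rfl
  have hunit : ∀ u : U, IsUnit (ψ u) := fun u ↦ by
    rw [PowerSeries.isUnit_iff_constantCoeff, hψ, ← PowerSeries.coeff_zero_eq_constantCoeff_apply,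
      coeff_dilation, homogeneousComponent_zero, ← constantCoeff_eq, ← eval_zero,
      eval_translation, zero_add]
    refine IsUnit.map C (Ne.isUnit ?_)
    rw [Ne, ← ha]
    exact hUm m hm u u.2
  obtain ⟨q, p, hq, hqp⟩ := hx.exists_fraction hn j (IsLocalization.lift hunit)
    (fun g ↦ by rw [hj, IsLocalization.lift_eq, hψ, AlgEquiv.apply_symm_apply])
    (fun r ↦ by
      obtain ⟨⟨g, u⟩, hgu⟩ := IsLocalization.surj U r
      refine ⟨translation a g, translation a u, ?_, ?_⟩
      · rw [hj, AlgEquiv.symm_apply_apply]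
        exact IsLocalization.map_units R u
      · rw [hj, hj, AlgEquiv.symm_apply_apply, AlgEquiv.symm_apply_apply]
        exact hgu)
  refine hx.exists_of_dvd_mul_sub (p := p) hq ?_
  refine IsDvdCoherent.dvd_of_locally (y := fun s ↦ q * x s - p) ?_ m (fun m' hm' ↦ ?_)
    fun s hs ↦ ?_
  · intro s t ht hst
    rw [sub_sub_sub_cancel_right, ← mul_sub]
    exact (hx ht hst).mul_left _
  · obtain ⟨b, hb⟩ := hpt m' hm'
    obtain ⟨f, hf, hfa, hfb⟩ := exists_prime_eval_eq_zero hn a b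
    have hne : algebraMap (MvPolynomial (Fin n) k) R f ≠ 0 := by
      rw [Ne, map_eq_zero_iff _ (IsLocalization.injective R
        (le_nonZeroDivisors_of_noZeroDivisors hU))]
      exact hf.ne_zero
    refine ⟨algebraMap _ R f, ?_, (ha f).mpr hfa, (hb f).mpr hfb⟩
    rw [← Ideal.span_singleton_prime hne, ← Set.image_singleton, ← Ideal.map_span]
    refine IsLocalization.isPrime_of_isPrime_disjoint U R _
      ((Ideal.span_singleton_prime hf.ne_zero).mpr hf) (Set.disjoint_left.mpr fun u hu huf ↦ ?_)
    have h1 := map_dvd (algebraMap _ R) (Ideal.mem_span_singleton.mp huf)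
    exact hUm m hm u hu (m.mem_of_dvd h1 ((ha f).mpr hfa))
  · obtain ⟨r, hr, hrs⟩ := exists_mem_dvd_one_sub_mul (Ideal.map j (idealOfVars (Fin n) k))
      (s := s) (y := q * x s - p) fun D ↦ by
        obtain ⟨z, hz, hzD⟩ := hqp s hs D
        refine ⟨q * z - p, ?_, hzD⟩
        rw [sub_sub_sub_cancel_right, ← mul_sub]
        exact hz.mul_left _
    refine ⟨1 - r, fun h1 ↦ hm.ne_top ((Ideal.eq_top_iff_one _).mpr ?_), hrs⟩
    have hle : Ideal.map j (idealOfVars (Fin n) k) ≤ m := by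
      rw [Ideal.map_le_iff_le_comap, idealOfVars, Ideal.span_le]
      rintro _ ⟨i, rfl⟩
      change j (X i) ∈ m
      rw [hj, ha, eval_translation_symm]
      simp
    simpa using add_mem h1 (hle hr)

end Translation

/-! ### Descent from the algebraic closure -/

section Descent

open MvPolynomial TensorProduct

attribute [local instance] MvPolynomial.algebraMvPolynomial Algebra.TensorProduct.rightAlgebra

/-- A `k`-linear retraction of `K` onto `k`, applied to coefficients, is `k[X]`-linear. -/
theorem exists_retraction_mvPolynomial (σ k K : Type*) [Field k] [Field K] [Algebra k K] :
    ∃ ρ : MvPolynomial σ K →ₗ[MvPolynomial σ k] MvPolynomial σ k, ρ 1 = 1 := by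
  obtain ⟨ρ₀, hρ₀⟩ := (Algebra.linearMap k K).exists_leftInverse_of_injective
    (LinearMap.ker_eq_bot.mpr (algebraMap k K).injective)
  have hρ₁ : ρ₀ 1 = 1 := by simpa using LinearMap.congr_fun hρ₀ 1
  have hb := (inferInstance :
    Algebra.IsPushout k (MvPolynomial σ k) K (MvPolynomial σ K)).out
  refine ⟨hb.lift (Algebra.linearMap k (MvPolynomial σ k) ∘ₗ ρ₀), ?_⟩
  have := hb.lift_eq (Algebra.linearMap k (MvPolynomial σ k) ∘ₗ ρ₀) 1
  simpa [hρ₁] using this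

/-- Descent along `R → R ⊗ K[X]` over `k[X]`, with `K` an algebraic closure of `k`. The tensor product
is a localization of `K[X]` and integral over `R`, so that its maximal ideals still contract to
maximal ideals. -/
theorem isDvdComplete_of_uncountable {k : Type u} [Field k] [Uncountable k] {n : ℕ} (hn : 2 ≤ n)
    (U : Submonoid (MvPolynomial (Fin n) k)) (hU : (0 : MvPolynomial (Fin n) k) ∉ U)
    (R : Type v) [CommRing R] [Algebra (MvPolynomial (Fin n) k) R] [IsLocalization U R]
    (hmax : ∀ m : Ideal R, m.IsMaximal →
      (m.comap (algebraMap (MvPolynomial (Fin n) k) R)).IsMaximal) : IsDvdComplete R := by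
  let P := MvPolynomial (Fin n) k
  let K := AlgebraicClosure k
  let PK := MvPolynomial (Fin n) K
  let A := R ⊗[P] PK
  have : Uncountable K := (algebraMap k K).injective.uncountable
  have : IsDomain R := IsLocalization.isDomain_of_le_nonZeroDivisors _
    (le_nonZeroDivisors_of_noZeroDivisors hU)
  have hinj : Function.Injective (algebraMap P PK) :=
    MvPolynomial.map_injective _ (algebraMap k K).injective
  let V := Algebra.algebraMapSubmonoid PK U
  have hV : (0 : PK) ∉ V := by
    rintro ⟨u, hu, h0⟩
    exact hU ((map_eq_zero_iff _ hinj).mp h0 ▸ hu)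
  have : IsLocalization V A := IsLocalization.tensorRight R U
  have : IsDomain A := IsLocalization.isDomain_of_le_nonZeroDivisors _
    (le_nonZeroDivisors_of_noZeroDivisors hV)
  obtain ⟨ρ, hρ⟩ := exists_retraction_mvPolynomial (Fin n) k K
  refine IsDvdComplete.of_retraction (A := A) (fun a ha ↦ ?_)
    ((TensorProduct.AlgebraTensorModule.rid P R R).toLinearMap ∘ₗ ρ.baseChange R)
    (by
      change TensorProduct.AlgebraTensorModule.rid P R R (ρ.baseChange R (1 ⊗ₜ[P] (1 : PK))) = 1
      rw [LinearMap.baseChange_tmul, hρ, TensorProduct.AlgebraTensorModule.rid_tmul, one_smul])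
    (isDvdComplete_of_isAlgClosed hn V hV A fun M hM ↦ ?_)
  · exact ((Algebra.IsIntegral.isIntegral (R := R) a).isAlgebraic).exists_nonzero_dvd
      (mem_nonZeroDivisors_of_ne_zero ha)
  · have h1 : (M.comap (algebraMap R A)).IsMaximal :=
      Ideal.isMaximal_comap_of_isIntegral_of_isMaximal M
    have h2 := hmax _ h1
    have h3 : (M.comap (algebraMap PK A)).comap (algebraMap P PK) =
        (M.comap (algebraMap R A)).comap (algebraMap P R) := by
      rw [Ideal.comap_comap, Ideal.comap_comap, ← IsScalarTower.algebraMap_eq,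
        ← IsScalarTower.algebraMap_eq]
    exact Ideal.isMaximal_of_isIntegral_of_isMaximal_comap (R := P) _ (h3 ▸ h2)

theorem not_isField_of_comap_isMaximal {k : Type*} [Field k] {n : ℕ} (hn : 2 ≤ n)
    {U : Submonoid (MvPolynomial (Fin n) k)} (hU : (0 : MvPolynomial (Fin n) k) ∉ U)
    (R : Type*) [CommRing R] [Algebra (MvPolynomial (Fin n) k) R] [IsLocalization U R]
    (hmax : ∀ m : Ideal R, m.IsMaximal →
      (m.comap (algebraMap (MvPolynomial (Fin n) k) R)).IsMaximal) : ¬ IsField R := by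
  intro hR
  let i₀ : Fin n := ⟨0, by lia⟩
  have hinj := IsLocalization.injective R (le_nonZeroDivisors_of_noZeroDivisors hU)
  have hbot := hmax ⊥ (by let := hR.toField; exact Ideal.bot_isMaximal)
  obtain ⟨y, z, hz, hy⟩ := hbot.exists_inv (x := X i₀) (by
    rw [Ideal.mem_comap, Ideal.mem_bot, map_eq_zero_iff _ hinj]
    exact X_ne_zero _)
  rw [Ideal.mem_comap, Ideal.mem_bot, map_eq_zero_iff _ hinj] at hz
  simpa [hz] using congrArg (eval 0) hy

theorem complete_and_ext_of_isLocalization {k : Type u} [Field k] [Uncountable k] {n : ℕ}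
    (hn : 2 ≤ n)
    (U : Submonoid (MvPolynomial (Fin n) k)) (hU : (0 : MvPolynomial (Fin n) k) ∉ U)
    (R : Type v) [CommRing R] [Algebra (MvPolynomial (Fin n) k) R] [IsLocalization U R]
    (hmax : ∀ m : Ideal R, m.IsMaximal →
      (m.comap (algebraMap (MvPolynomial (Fin n) k) R)).IsMaximal) :
    IsNonzeroAdicComplete R ∧ ExtOneFractionRingVanishes R := by
  have : IsDomain R := IsLocalization.isDomain_of_le_nonZeroDivisors _
    (le_nonZeroDivisors_of_noZeroDivisors hU)
  have h := isDvdComplete_of_uncountable hn U hU R hmax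
  exact ⟨h.isNonzeroAdicComplete (not_isField_of_comap_isMaximal hn hU R hmax),
    h.extOneFractionRingVanishes⟩

end Descent

theorem theorem13 (k : Type u) [Field k] (hk : ℵ₁ ≤ #k) (n : ℕ) (hn : 2 ≤ n) :
    (∀ (U : Submonoid (MvPolynomial (Fin n) k)), (0 : MvPolynomial (Fin n) k) ∉ U →
      ∀ (R : Type v) [CommRing R] [Algebra (MvPolynomial (Fin n) k) R] [IsLocalization U R],
        (∀ m : Ideal R, m.IsMaximal →
          (m.comap (algebraMap (MvPolynomial (Fin n) k) R)).IsMaximal) →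
        IsNonzeroAdicComplete R ∧ ExtOneFractionRingVanishes R) ∧
    (IsNonzeroAdicComplete (MvPolynomial (Fin n) k) ∧
      ExtOneFractionRingVanishes (MvPolynomial (Fin n) k)) ∧
    (∀ (m : Ideal (MvPolynomial (Fin n) k)) [m.IsMaximal],
      IsNonzeroAdicComplete (Localization.AtPrime m) ∧
        ExtOneFractionRingVanishes (Localization.AtPrime m)) := by
  have : Uncountable k := by
    rw [← Cardinal.aleph0_lt_mk_iff]
    exact Cardinal.aleph0_lt_aleph_one.trans_le hk
  refine ⟨fun U hU R _ _ _ hmax ↦ complete_and_ext_of_isLocalization hn U hU R hmax, ?_,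
    fun m _ ↦ ?_⟩
  · have : IsLocalization (⊥ : Submonoid (MvPolynomial (Fin n) k)) (MvPolynomial (Fin n) k) :=
      IsLocalization.self (by simp)
    exact complete_and_ext_of_isLocalization hn ⊥ (by simp [Submonoid.mem_bot]) _ fun m hm ↦ hm
  · refine complete_and_ext_of_isLocalization hn m.primeCompl (fun h ↦ h m.zero_mem) _
      fun M hM ↦ ?_
    have h := Localization.AtPrime.under_maximalIdeal (I := m)
    rw [Ideal.under_def] at h
    rw [IsLocalRing.eq_maximalIdeal hM]
    exact h.symm ▸ inferInstance
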